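/- Let $\ell,n\in\mathbb{N}_0$. A function $\sigma\in C^{\ell}(\mathbb{R})$ is called $\ell$-finite if $0<\int_{\mathbb{R}}\bigl|\tfrac{d^{\ell}\sigma}{dx^{\ell}}\bigr|\,dx<\infty$. For a compact set $K\subset\mathbb{R}^n$, $f\in C^{\ell}(K)$ means that $f$ is a real-valued $C^{\ell}$ function on an open neighbourhood of $K$, and, for a function $h$ that is $C^r$ near $K$, $\lVert h\rVert_{C^r}=\sum_{i=0}^{r}\sup_{x\in K}\lVert D^{i}h(x)\rVert$, where $D^i h(x)$ is the $i$-th derivative with its operator norm. **Theorem (Random Universal Approximation Theorem).** Let $K\subset\mathbb{R}^n$ be compact, let $f\in C^{\ell}(K)$, and let $\sigma\in C^{\ell}(\mathbb{R})$ be $\ell$-finite. Let $(b_j)_{j\in\mathbb{N}}$ and $(C_j)_{j\in\mathbb{N}}$ be random variables with values in $\mathbb{R}$ and $\mathbb{R}^n$ on a common probability space, such that the pairs $(b_j,C_j)$, $j\in\mathbb{N}$, are independent and identically distributed and their common law has full support, i.e. it gives positive probability to every nonempty open subset of $\mathbb{R}\times\mathbb{R}^n$. (This is the case, for instance, if $(b_j)$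 and $(C_j)$ are independent of each other and each is an i.i.d. sequence with full support.) Then for every integer $0\le r\le\ell$, every $\alpha<1$ and every $\epsilon>0$ there is $N\in\mathbb{N}$ such that the set of outcomes for which there exist $W_1,\dots,W_N\in\mathbb{R}$ such that the random neural network $$g(x)=\sum_{j=1}^{N}W_j\,\sigma(C_j^{\top}x+b_j)$$ satisfies $\lVert f-g\rVert_{C^r}<\epsilon$ is an event (a measurable set) of probability greater than $\alpha$. -/

import Mathlib

open MeasureTheory ProbabilityTheory

open scoped ENNReal

/-- A scalar function `σ` of class `C^ℓ` is `ℓ`-finite if `0 < ∫ |d^ℓ σ / dx^ℓ| dx < ∞`. -/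
def IsEllFinite (ℓ : ℕ) (σ : ℝ → ℝ) : Prop :=
  ContDiff ℝ ℓ σ ∧ 0 < ∫⁻ x, ‖iteratedDeriv ℓ σ x‖ₑ ∧ ∫⁻ x, ‖iteratedDeriv ℓ σ x‖ₑ < ∞

/-- The `C^r` norm over `K`, with values in `[0, ∞]`: the sum over the orders `i = 0, …, r` of the
supremum over `x ∈ K` of the operator norm of the `i`-th total derivative of `h` at `x`. -/
noncomputable def crNorm {E : Type*} [NormedAddCommGroup E] [NormedSpace ℝ E]
    (r : ℕ) (K : Set E) (h : E → ℝ) : ℝ≥0∞ :=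
  ∑ i ∈ Finset.range (r + 1), ⨆ x ∈ K, ‖iteratedFDeriv ℝ i h x‖ₑ

/-- The neural network with one hidden layer of `N` neurons, `x ↦ ∑ j, W j * σ (C jᵀ x + b j)`. -/
noncomputable def network {n N : ℕ} (σ : ℝ → ℝ) (W : Fin N → ℝ)
    (C : Fin N → EuclideanSpace ℝ (Fin n)) (b : Fin N → ℝ) (x : EuclideanSpace ℝ (Fin n)) : ℝ :=
  ∑ j, W j * σ (inner ℝ (C j) x + b j)

/-! ### Parametric families of functions of class `C^r` -/

section Parametric

variable {Z E : Type*} [NormedAddCommGroup Z] [NormedSpace ℝ Z] [NormedAddCommGroup E]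
  [NormedSpace ℝ E] {r : ℕ} {F : Z → E → ℝ}

/-! Approximation in `C^r` over `K` is approximation in the Banach space `JetSpace r K`, which `jet`
maps into. Let `A` be the closed span of the jets of all neurons `x ↦ σ(⟨w, x⟩ + b)`. A closed
subspace contains the integrals of its integrable families (`LocallyDominated.jet_integral_mem`),
and integrating over biases and weights fills it up.

With `φ` a test function, `g = φ ⋆ σ^(ℓ) = φ^(ℓ) ⋆ σ` is an average of translates of `σ`, so its
ridge functions lie in `A`; unlike `σ`, it is integrable, and `φ` can be chosen with `g ≠ 0`. Its
Fourier transform is nonzero at some `ξ ≠ 0`. Convolving `g` with waves of frequency `ξ` only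
multiplies their amplitude by that number, so `A` contains all ridge waves of frequency `ξ`, and
rescaling `w` gives every frequency. Fourier inversion yields the smooth compactly supported
functions, mollification the `C^r` ones, and a cutoff near `K` handles `f`.

For the random part, fix one approximating network with `M` neurons. The error is continuous in the
parameters, so each neuron may move in an open set `O k`. Full support and independence make a long
sample hit every `O k` with probability close to 1 (`exists_lt_measureReal_forall_exists_mem`); the
other neurons get weight 0. The event is measurable because the good parameters form an open set. -/

theorem ContDiff.of_uncurry (hF : ContDiff ℝ r (Function.uncurry F)) (z : Z) :
    ContDiff ℝ r (F z) :=
  hF.comp (contDiff_const.prodMk contDiff_id)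

/-- Restricting the full derivative to directions in `E` makes joint continuity in `(z, x)`
immediate. -/
theorem ContDiff.iteratedFDeriv_of_uncurry (hF : ContDiff ℝ r (Function.uncurry F)) {i : ℕ}
    (hi : i ≤ r) (z : Z) (x : E) :
    iteratedFDeriv ℝ i (F z) x = (iteratedFDeriv ℝ i (Function.uncurry F)
      (z, x)).compContinuousLinearMap fun _ => ContinuousLinearMap.inr ℝ Z E := by
  have h1 : F z = (fun p => Function.uncurry F ((z, 0) + p)) ∘ ContinuousLinearMap.inr ℝ Z E := by
    ext y; simp
  have h2 : ContDiff ℝ r (fun p => Function.uncurry F ((z, 0) + p)) := by fun_prop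
  rw [h1, ContinuousLinearMap.iteratedFDeriv_comp_right _ h2 _ (by exact_mod_cast hi),
    iteratedFDeriv_comp_add_left]
  simp

theorem ContDiff.continuous_iteratedFDeriv_of_uncurry (hF : ContDiff ℝ r (Function.uncurry F))
    {i : ℕ} (hi : i ≤ r) : Continuous fun p : Z × E => iteratedFDeriv ℝ i (F p.1) p.2 := by
  simp only [hF.iteratedFDeriv_of_uncurry hi]
  exact (ContinuousMultilinearMap.compContinuousLinearMapL
    (fun _ : Fin i => ContinuousLinearMap.inr ℝ Z E)).continuous.comp
    (hF.continuous_iteratedFDeriv (by exact_mod_cast hi))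

/-- On bounded sets, the derivatives of the functions `F z` up to the order `r` are dominated by
integrable functions of `z`. -/
def LocallyDominated [MeasurableSpace Z] (μ : Measure Z) (r : ℕ) (F : Z → E → ℝ) : Prop :=
  ∀ i ≤ r, ∀ R : ℝ, ∃ B : Z → ℝ, Integrable B μ ∧
    ∀ z x, ‖x‖ ≤ R → ‖iteratedFDeriv ℝ i (F z) x‖ ≤ B z

variable [MeasurableSpace Z] [BorelSpace Z] [SecondCountableTopology Z] {μ : Measure Z}

theorem LocallyDominated.hasFTaylorSeriesUpTo_integral (hB : LocallyDominated μ r F)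
    (hF : ContDiff ℝ r (Function.uncurry F)) :
    HasFTaylorSeriesUpTo r (fun x => ∫ z, F z x ∂μ)
      (fun x i => ∫ z, iteratedFDeriv ℝ i (F z) x ∂μ) := by
  have hc : ∀ i ≤ r, ∀ x, Continuous fun z => iteratedFDeriv ℝ i (F z) x := fun i hi x =>
    (hF.continuous_iteratedFDeriv_of_uncurry hi).comp (Continuous.prodMk_left x)
  have hm : ∀ i ≤ r, ∀ x, AEStronglyMeasurable (fun z => iteratedFDeriv ℝ i (F z) x) μ :=
    fun i hi x => (hc i hi x).aestronglyMeasurable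
  have hint : ∀ i ≤ r, ∀ x, Integrable (fun z => iteratedFDeriv ℝ i (F z) x) μ := by
    intro i hi x
    obtain ⟨B, hBi, hBb⟩ := hB i hi ‖x‖
    exact hBi.mono' (hm i hi x) (.of_forall fun z => hBb z x le_rfl)
  have hball : ∀ x y : E, y ∈ Metric.ball x 1 → ‖y‖ ≤ ‖x‖ + 1 := by
    intro x y hy
    have h1 := norm_le_norm_add_norm_sub' y x
    have h2 := mem_ball_iff_norm.1 hy
    linarith
  refine ⟨fun x => ?_, fun m hmr x => ?_, fun m hmr => ?_⟩
  · change continuousMultilinearCurryFin0 ℝ E ℝ _ = _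
    rw [← LinearIsometryEquiv.coe_toContinuousLinearEquiv,
      ← ContinuousLinearEquiv.integral_comp_comm]
    simp
  · have hmr' : m < r := by exact_mod_cast hmr
    -- Radius `‖x‖ + 1` covers the unit ball around `x`, where differentiation under the integral
    -- needs a uniform bound.
    obtain ⟨B, hBi, hBb⟩ := hB (m + 1) hmr' (‖x‖ + 1)
    have key := hasFDerivAt_integral_of_dominated_of_fderiv_le (μ := μ) (𝕜 := ℝ)
      (F := fun x z => iteratedFDeriv ℝ m (F z) x)
      (F' := fun x z => (iteratedFDeriv ℝ (m + 1) (F z) x).curryLeft) (bound := B)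
      (Metric.ball_mem_nhds x one_pos) (.of_forall fun y => hm m hmr'.le y) (hint m hmr'.le x)
      ((continuousMultilinearCurryLeftEquiv ℝ (fun _ : Fin (m + 1) => E) ℝ).continuous.comp
        (hc (m + 1) hmr' x)).aestronglyMeasurable
      (.of_forall fun z y hy => by
        rw [ContinuousMultilinearMap.curryLeft_norm]
        exact hBb z y (hball x y hy)) hBi
      (.of_forall fun z y _ => (contDiff_iff_ftaylorSeries.1 (hF.of_uncurry z)).fderiv m hmr y)
    convert! key using 1
    exact (ContinuousLinearEquiv.integral_comp_comm (𝕜 := ℝ)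
      (E := ContinuousMultilinearMap ℝ (fun _ : Fin (m + 1) => E) ℝ)
      (F := E →L[ℝ] ContinuousMultilinearMap ℝ (fun _ : Fin m => E) ℝ)
      (continuousMultilinearCurryLeftEquiv ℝ (fun _ : Fin (m + 1) => E)
        ℝ).toContinuousLinearEquiv (fun z => iteratedFDeriv ℝ (m + 1) (F z) x)).symm
  · have hmr' : m ≤ r := by exact_mod_cast hmr
    refine continuous_iff_continuousAt.2 fun x => ?_
    obtain ⟨B, hBi, hBb⟩ := hB m hmr' (‖x‖ + 1)
    refine continuousAt_of_dominated (bound := B) (.of_forall fun y => hm m hmr' y) ?_ hBi ?_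
    · filter_upwards [Metric.ball_mem_nhds x one_pos] with y hy
      exact .of_forall fun z => hBb z y (hball x y hy)
    · exact .of_forall fun z => ((hF.of_uncurry z).continuous_iteratedFDeriv
        (by exact_mod_cast hmr')).continuousAt

theorem LocallyDominated.contDiff_integral (hB : LocallyDominated μ r F)
    (hF : ContDiff ℝ r (Function.uncurry F)) : ContDiff ℝ r fun x => ∫ z, F z x ∂μ :=
  (hB.hasFTaylorSeriesUpTo_integral hF).contDiff

theorem LocallyDominated.iteratedFDeriv_integral (hB : LocallyDominated μ r F)
    (hF : ContDiff ℝ r (Function.uncurry F)) {i : ℕ} (hi : i ≤ r) (x : E) :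
    iteratedFDeriv ℝ i (fun x => ∫ z, F z x ∂μ) x = ∫ z, iteratedFDeriv ℝ i (F z) x ∂μ :=
  ((hB.hasFTaylorSeriesUpTo_integral hF).eq_iteratedFDeriv (by exact_mod_cast hi) x).symm

omit [SecondCountableTopology Z] in
theorem LocallyDominated.of_isCompact [ProperSpace E] [IsFiniteMeasureOnCompacts μ] {S : Set Z}
    (hS : IsCompact S) (hF : ContDiff ℝ r (Function.uncurry F))
    (h0 : ∀ z ∉ S, F z = 0) : LocallyDominated μ r F := by
  intro i hi R
  obtain ⟨M, hM⟩ := (hS.prod (isCompact_closedBall (0 : E) R)).exists_bound_of_continuousOn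
    (hF.continuous_iteratedFDeriv_of_uncurry hi).continuousOn
  refine ⟨S.indicator fun _ => M, (integrable_indicator_iff hS.measurableSet).2
    (integrableOn_const hS.measure_lt_top.ne), fun z x hx => ?_⟩
  by_cases hz : z ∈ S
  · rw [Set.indicator_of_mem hz]
    exact hM (z, x) ⟨hz, by simpa using hx⟩
  · rw [Set.indicator_of_notMem hz, h0 z hz, Pi.zero_def, iteratedFDeriv_fun_zero]
    simp

end Parametric

/-! ### Jets over a compact set -/

section Jet

variable {E : Type*} [NormedAddCommGroup E] [NormedSpace ℝ E]

variable {r : ℕ} {K : Set E}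

/-- The families of continuous fields of multilinear forms on `K`, of degrees `0, …, r`. -/
def JetSpace (r : ℕ) (K : Set E) : Type _ :=
  (i : Fin (r + 1)) → C(K, ContinuousMultilinearMap ℝ (fun _ : Fin i => E) ℝ)

noncomputable instance [CompactSpace K] : NormedAddCommGroup (JetSpace r K) :=
  inferInstanceAs (NormedAddCommGroup
    ((i : Fin (r + 1)) → C(K, ContinuousMultilinearMap ℝ (fun _ : Fin i => E) ℝ)))

noncomputable instance [CompactSpace K] : NormedSpace ℝ (JetSpace r K) :=
  inferInstanceAs (NormedSpace ℝ
    ((i : Fin (r + 1)) → C(K, ContinuousMultilinearMap ℝ (fun _ : Fin i => E) ℝ)))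

instance [CompactSpace K] : CompleteSpace (JetSpace r K) :=
  inferInstanceAs (CompleteSpace
    ((i : Fin (r + 1)) → C(K, ContinuousMultilinearMap ℝ (fun _ : Fin i => E) ℝ)))

variable (K) in
/-- The derivatives of `h` up to the order `r`, restricted to `K`. -/
noncomputable def jet (h : E → ℝ) (hh : ContDiff ℝ r h) : JetSpace r K := fun i =>
  ⟨fun x => iteratedFDeriv ℝ i h x, (hh.continuous_iteratedFDeriv
    (by exact_mod_cast Nat.lt_succ_iff.1 i.2)).comp continuous_subtype_val⟩

theorem JetSpace.ext {p q : JetSpace r K} (h : ∀ i x, p i x = q i x) : p = q :=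
  funext fun i => ContinuousMap.ext (h i)

@[simp]
theorem jet_apply {h : E → ℝ} (hh : ContDiff ℝ r h) (i : Fin (r + 1)) (x : K) :
    jet K h hh i x = iteratedFDeriv ℝ i h x := rfl

theorem jet_congr {h h' : E → ℝ} (e : h = h') (hh : ContDiff ℝ r h) (hh' : ContDiff ℝ r h') :
    jet K h hh = jet K h' hh' := by subst e; rfl

variable [CompactSpace K]

theorem JetSpace.norm_apply_le (p : JetSpace r K) (i : Fin (r + 1)) (x : K) : ‖p i x‖ ≤ ‖p‖ :=
  ((p i).norm_coe_le_norm x).trans (norm_le_pi_norm (G := fun i : Fin (r + 1) =>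
    C(K, ContinuousMultilinearMap ℝ (fun _ : Fin i => E) ℝ)) p i)

theorem JetSpace.norm_le {p : JetSpace r K} {M : ℝ} (hM : 0 ≤ M) (h : ∀ i x, ‖p i x‖ ≤ M) :
    ‖p‖ ≤ M :=
  (pi_norm_le_iff_of_nonneg (G := fun i : Fin (r + 1) =>
    C(K, ContinuousMultilinearMap ℝ (fun _ : Fin i => E) ℝ)) hM).2 fun i =>
      (ContinuousMap.norm_le _ hM).2 (h i)

/-- Evaluation of the component of degree `i` at a point. -/
noncomputable def JetSpace.eval (i : Fin (r + 1)) (x : K) :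
    JetSpace r K →L[ℝ] ContinuousMultilinearMap ℝ (fun _ : Fin i => E) ℝ :=
  LinearMap.mkContinuous
    { toFun := fun p => p i x
      map_add' := fun _ _ => rfl
      map_smul' := fun _ _ => rfl } 1 fun p =>
    (p.norm_apply_le i x).trans_eq (one_mul _).symm

theorem jet_add {g h : E → ℝ} (hg : ContDiff ℝ r g) (hh : ContDiff ℝ r h) :
    jet K (fun x => g x + h x) (hg.add hh) = jet K g hg + jet K h hh :=
  JetSpace.ext fun i x => iteratedFDeriv_add_apply
    (hg.of_le (by exact_mod_cast Nat.lt_succ_iff.1 i.2)).contDiffAt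
    (hh.of_le (by exact_mod_cast Nat.lt_succ_iff.1 i.2)).contDiffAt

theorem jet_const_smul (c : ℝ) {h : E → ℝ} (hh : ContDiff ℝ r h) :
    jet K (fun x => c * h x) (contDiff_const.mul hh) = c • jet K h hh :=
  JetSpace.ext fun i x => iteratedFDeriv_const_smul_apply (a := c)
    (hh.of_le (by exact_mod_cast Nat.lt_succ_iff.1 i.2)).contDiffAt

theorem jet_sub {g h : E → ℝ} (hg : ContDiff ℝ r g) (hh : ContDiff ℝ r h) :
    jet K (fun x => g x - h x) (hg.sub hh) = jet K g hg - jet K h hh := by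
  rw [sub_eq_add_neg, ← neg_one_smul ℝ (jet K h hh), ← jet_const_smul, ← jet_add]
  exact jet_congr (by ext; ring) _ _

theorem jet_sum_smul {ι : Type*} (s : Finset ι) (c : ι → ℝ) {h : ι → E → ℝ}
    (hh : ∀ j, ContDiff ℝ r (h j)) :
    jet K (fun x => ∑ j ∈ s, c j * h j x)
      (ContDiff.sum fun j _ => contDiff_const.mul (hh j)) = ∑ j ∈ s, c j • jet K (h j) (hh j) := by
  classical
  induction s using Finset.induction_on with
  | empty =>
    refine JetSpace.ext fun i x => ?_
    simp only [Finset.sum_empty, jet_apply, iteratedFDeriv_fun_zero]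
    rfl
  | insert a s ha ih =>
    rw [Finset.sum_insert ha, ← ih, ← jet_const_smul, ← jet_add]
    exact jet_congr (by ext x; rw [Finset.sum_insert ha]) _ _

/-- The sum of the norms of the components of a jet. -/
noncomputable def JetSpace.sumNorm (p : JetSpace r K) : ℝ≥0∞ := ∑ i, ‖p i‖ₑ

theorem JetSpace.sumNorm_zero : (0 : JetSpace r K).sumNorm = 0 :=
  Finset.sum_eq_zero fun i _ => by
    rw [ContinuousMap.enorm_eq_iSup_enorm]
    refine ENNReal.iSup_eq_zero.2 fun x => ?_
    rw [← ofReal_norm, ENNReal.ofReal_eq_zero]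
    exact (JetSpace.norm_apply_le 0 i x).trans_eq norm_zero

theorem JetSpace.continuous_sumNorm : Continuous (JetSpace.sumNorm : JetSpace r K → ℝ≥0∞) :=
  continuous_finsetSum _ fun i _ => continuous_enorm.comp (continuous_apply (A := fun i : Fin (r + 1)
    => C(K, ContinuousMultilinearMap ℝ (fun _ : Fin i => E) ℝ)) i)

theorem crNorm_eq_sumNorm_jet {h : E → ℝ} (hh : ContDiff ℝ r h) :
    crNorm r K h = (jet K h hh).sumNorm := by
  rw [crNorm, Finset.sum_range]
  refine Finset.sum_congr rfl fun i _ => ?_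
  rw [ContinuousMap.enorm_eq_iSup_enorm, iSup_subtype']
  rfl

variable {Z : Type*} [NormedAddCommGroup Z] [NormedSpace ℝ Z] {F : Z → E → ℝ}

/-- Joint continuity of the derivatives in `(z, x)` becomes uniform convergence over the compact set
`K`. -/
theorem continuous_jet (hF : ContDiff ℝ r (Function.uncurry F)) :
    Continuous fun z => jet K (F z) (hF.of_uncurry z) :=
  (continuous_pi fun i => ContinuousMap.continuous_of_continuous_uncurry _
    ((hF.continuous_iteratedFDeriv_of_uncurry (Nat.lt_succ_iff.1 i.2)).comp
      (continuous_fst.prodMk (continuous_subtype_val.comp continuous_snd))) :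
    Continuous (Y := (i : Fin (r + 1)) → C(K, ContinuousMultilinearMap ℝ (fun _ : Fin i => E) ℝ))
      fun z => jet K (F z) (hF.of_uncurry z))

variable [MeasurableSpace Z] [BorelSpace Z] [SecondCountableTopology Z] {μ : Measure Z}

theorem LocallyDominated.integrable_jet (hB : LocallyDominated μ r F)
    (hF : ContDiff ℝ r (Function.uncurry F)) :
    Integrable (fun z => jet K (F z) (hF.of_uncurry z)) μ := by
  obtain ⟨R, hR⟩ := (isCompact_iff_compactSpace.2 ‹_› : IsCompact K).isBounded.exists_norm_le
  choose B hBi hBb using fun i : Fin (r + 1) => hB i (Nat.lt_succ_iff.1 i.2) R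
  refine (integrable_finsetSum Finset.univ fun i _ => (hBi i).norm).mono'
    (continuous_jet hF).aestronglyMeasurable
    (.of_forall fun z => JetSpace.norm_le (Finset.sum_nonneg fun _ _ => norm_nonneg _) fun i x => ?_)
  exact ((hBb i z x (hR x x.2)).trans (le_abs_self _)).trans
    (Finset.single_le_sum (f := fun i => ‖B i z‖) (fun _ _ => norm_nonneg _) (Finset.mem_univ i))

theorem LocallyDominated.jet_integral (hB : LocallyDominated μ r F)
    (hF : ContDiff ℝ r (Function.uncurry F)) :
    jet K _ (hB.contDiff_integral hF) = ∫ z, jet K (F z) (hF.of_uncurry z) ∂μ := by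
  refine JetSpace.ext fun i x => ?_
  have h := (JetSpace.eval i x).integral_comp_comm (hB.integrable_jet (K := K) hF)
  rw [jet_apply, hB.iteratedFDeriv_integral hF (Nat.lt_succ_iff.1 i.2)]
  exact h

theorem Submodule.integral_mem_of_isClosed {Y : Type*} [NormedAddCommGroup Y] [NormedSpace ℝ Y]
    [CompleteSpace Y] {A : Submodule ℝ Y} (hA : IsClosed (A : Set Y)) {α : Type*}
    [MeasurableSpace α] {ν : Measure α} {f : α → Y} (hfi : Integrable f ν) (hf : ∀ a, f a ∈ A) :
    ∫ a, f a ∂ν ∈ A := by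
  by_contra h
  obtain ⟨g, u, hgu, hu⟩ := geometric_hahn_banach_closed_point A.convex hA h
  have hg : ∀ a ∈ A, g a = 0 := by
    intro a ha
    by_contra hne
    -- A functional bounded above by `u` on a subspace vanishes there: otherwise some multiple of
    -- `a` takes the value `u + 1`.
    have := hgu (((u + 1) / g a) • a) (A.smul_mem _ ha)
    rw [map_smul, smul_eq_mul, div_mul_cancel₀ _ hne] at this
    linarith
  have h0 := hgu 0 A.zero_mem
  rw [← g.integral_comp_comm hfi] at hu
  simp only [hg _ (hf _), integral_zero, map_zero] at hu h0
  linarith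

theorem LocallyDominated.jet_integral_mem {A : Submodule ℝ (JetSpace r K)}
    (hA : IsClosed (A : Set (JetSpace r K))) (hB : LocallyDominated μ r F)
    (hF : ContDiff ℝ r (Function.uncurry F)) (h : ∀ z, jet K (F z) (hF.of_uncurry z) ∈ A) :
    jet K _ (hB.contDiff_integral hF) ∈ A := by
  rw [hB.jet_integral hF]
  exact Submodule.integral_mem_of_isClosed hA (hB.integrable_jet hF) h

end Jet

/-! ### Convolutions on the line -/

section Line

open scoped Convolution ContDiff

theorem HasCompactSupport.iterated_deriv {φ : ℝ → ℝ} (hφ : HasCompactSupport φ) (k : ℕ) :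
    HasCompactSupport (iteratedDeriv k φ) := by
  induction k with
  | zero => simpa using hφ
  | succ k ih => rw [iteratedDeriv_succ]; exact ih.deriv

theorem ContDiff.iterated_deriv {φ : ℝ → ℝ} (hφ : ContDiff ℝ ∞ φ) (k : ℕ) :
    ContDiff ℝ ∞ (iteratedDeriv k φ) := by
  rw [iteratedDeriv_eq_iterate]
  exact hφ.iterate_deriv k

variable {φ : ℝ → ℝ}

theorem HasCompactSupport.iteratedDeriv_convolution_left (hφ : HasCompactSupport φ)
    (hφ' : ContDiff ℝ ∞ φ) {s : ℝ → ℝ} (hs : LocallyIntegrable s) (k : ℕ) :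
    iteratedDeriv k (φ ⋆ s) = iteratedDeriv k φ ⋆ s := by
  induction k with
  | zero => simp
  | succ k ih =>
    rw [iteratedDeriv_succ, ih, iteratedDeriv_succ]
    ext x
    exact ((hφ.iterated_deriv k).hasDerivAt_convolution_left _
      ((hφ'.iterated_deriv k).of_le (by exact_mod_cast le_top)) hs x).deriv

theorem HasCompactSupport.convolution_deriv (hφ : HasCompactSupport φ) (hφ' : ContDiff ℝ ∞ φ)
    {τ : ℝ → ℝ} (hτ : ContDiff ℝ 1 τ) : φ ⋆ deriv τ = deriv φ ⋆ τ := by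
  ext x
  have hd : Differentiable ℝ τ := hτ.differentiable one_ne_zero
  have hv : ∀ y, HasDerivAt (fun y => τ (x - y)) (-deriv τ (x - y)) y := fun y => by
    simpa using (hd (x - y)).hasDerivAt.comp_const_sub x y
  have hτc : Continuous τ := hτ.continuous
  have hτd : Continuous (deriv τ) := hτ.continuous_deriv le_rfl
  have hφc : Continuous φ := hφ'.continuous
  have hφd : Continuous (deriv φ) := hφ'.continuous_deriv (by exact_mod_cast le_top)
  have key := integral_mul_deriv_eq_deriv_mul_of_integrable (u := φ) (u' := deriv φ)
    (v := fun y => τ (x - y)) (v' := fun y => -deriv τ (x - y))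
    (fun y _ => (hφ'.differentiable (by simp) y).hasDerivAt) (fun y _ => hv y)
    ((hφc.mul (by fun_prop)).integrable_of_hasCompactSupport hφ.mul_right)
    ((hφd.mul (by fun_prop)).integrable_of_hasCompactSupport hφ.deriv.mul_right)
    ((hφc.mul (by fun_prop)).integrable_of_hasCompactSupport hφ.mul_right)
  simp only [mul_neg, integral_neg, neg_inj] at key
  simpa [convolution_def] using key

/-- Repeated integration by parts, without boundary terms. This ties the integrable `σ^(ℓ)` back to
averages of `σ` itself. -/
theorem HasCompactSupport.convolution_iteratedDeriv (hφ : HasCompactSupport φ)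
    (hφ' : ContDiff ℝ ∞ φ) {k : ℕ} {σ : ℝ → ℝ} (hσ : ContDiff ℝ k σ) :
    φ ⋆ iteratedDeriv k σ = iteratedDeriv k φ ⋆ σ := by
  induction k generalizing φ with
  | zero => simp
  | succ k ih =>
    have hσ' : ContDiff ℝ 1 (iteratedDeriv k σ) := by
      rw [iteratedDeriv_eq_iterate]
      refine ContDiff.iterate_deriv' 1 k ?_
      rw [add_comm]
      exact_mod_cast hσ
    have hφd : ContDiff ℝ ∞ (deriv φ) := by simpa using hφ'.iterated_deriv 1
    rw [iteratedDeriv_succ, hφ.convolution_deriv hφ' hσ',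
      ih hφ.deriv hφd (hσ.of_le (by exact_mod_cast k.le_succ)), iteratedDeriv_succ']

/-- For `|t| ≤ R` all the shifts `φ (t + ·)` are dominated by one multiple `χ` of the indicator of a
ball, and `χ ⋆ |s|` is integrable. -/
theorem HasCompactSupport.exists_integrable_bound_convolution (hφ : HasCompactSupport φ)
    (hφc : Continuous φ) {s : ℝ → ℝ} (hs : Integrable s) (R : ℝ) :
    ∃ B : ℝ → ℝ, Integrable B ∧ ∀ t y, |t| ≤ R → |(φ ⋆ s) (t - y)| ≤ B y := by
  obtain ⟨ρ, hρ⟩ := hφ.isBounded.exists_norm_le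
  obtain ⟨M, hM⟩ := hφ.exists_bound_of_continuous hφc
  have hM0 : 0 ≤ M := (norm_nonneg _).trans (hM 0)
  let χ : ℝ → ℝ := (Metric.closedBall 0 (ρ + R)).indicator fun _ => M
  have hχ : Integrable χ := (integrable_indicator_iff Metric.isClosed_closedBall.measurableSet).2
    (integrableOn_const (isCompact_closedBall _ _).measure_lt_top.ne)
  refine ⟨fun y => (χ ⋆ fun u => |s u|) (-y),
    (hχ.integrable_convolution _ hs.abs).comp_neg, fun t y ht => ?_⟩
  have hχM : ∀ v, ‖χ v‖ ≤ M := fun v => by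
    simp only [χ, Set.indicator]; split_ifs <;> simp [abs_of_nonneg hM0, hM0]
  have hle : ∀ v, |φ (t + v)| ≤ χ v := by
    intro v
    by_cases hv : v ∈ Metric.closedBall (0 : ℝ) (ρ + R)
    · simpa [χ, Set.indicator_of_mem hv] using hM (t + v)
    · have : φ (t + v) = 0 := by
        by_contra h
        have h1 := hρ _ (subset_tsupport _ h)
        have h2 := abs_sub_abs_le_abs_add v t
        rw [mem_closedBall_zero_iff, Real.norm_eq_abs] at hv
        rw [Real.norm_eq_abs, add_comm] at h1
        linarith
      simp [χ, Set.indicator_of_notMem hv, this]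
  change |(φ ⋆ s) (t - y)| ≤ (χ ⋆ fun u => |s u|) (-y)
  rw [convolution_def, convolution_def, ← integral_add_left_eq_self _ t, ← Real.norm_eq_abs]
  refine norm_integral_le_of_norm_le ?_ (.of_forall fun v => ?_)
  · exact (hs.abs.comp_sub_left (-y)).bdd_mul hχ.aestronglyMeasurable (.of_forall hχM)
  · simp only [ContinuousLinearMap.lsmul_apply, smul_eq_mul, norm_mul, Real.norm_eq_abs]
    rw [show t - y - (t + v) = -y - v by ring]
    exact mul_le_mul_of_nonneg_right (hle v) (abs_nonneg _)

theorem exists_convolution_ne_zero {s : ℝ → ℝ} (hs : Continuous s) (h0 : s ≠ 0) :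
    ∃ φ : ℝ → ℝ, HasCompactSupport φ ∧ ContDiff ℝ ∞ φ ∧ φ ⋆ s ≠ 0 := by
  obtain ⟨x, hx⟩ := Function.ne_iff.1 h0
  let ψ : ℕ → ContDiffBump (0 : ℝ) := fun k =>
    ⟨1 / (k + 1 : ℝ) / 2, 1 / (k + 1 : ℝ), by positivity, half_lt_self (by positivity)⟩
  have ht := ContDiffBump.convolution_tendsto_right_of_continuous (μ := volume) (φ := ψ)
    (l := Filter.atTop) tendsto_one_div_add_atTop_nhds_zero_nat hs x
  obtain ⟨k, hk⟩ := (ht.eventually_ne hx).exists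
  exact ⟨_, (ψ k).hasCompactSupport_normed, (ψ k).contDiff_normed,
    fun h => hk (by simpa using congrFun h x)⟩

open scoped FourierTransform

theorem exists_fourier_ne_zero {g : ℝ → ℝ} (hg : Continuous g) (hi : Integrable g) (h0 : g ≠ 0) :
    ∃ ξ : ℝ, ξ ≠ 0 ∧ 𝓕 (fun t => (g t : ℂ)) ξ ≠ 0 := by
  by_contra! h
  have hi' : Integrable fun t => (g t : ℂ) := hi.ofReal
  have hF : 𝓕 (fun t => (g t : ℂ)) = 0 := by
    have hc : Continuous (𝓕 (fun t => (g t : ℂ))) :=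
      VectorFourier.fourierIntegral_continuous Real.continuous_fourierChar
        (innerSL ℝ).continuous₂ hi'
    -- Continuity of the transform excludes that it lives at frequency 0 alone, which would give
    -- only constants.
    exact hc.ext_on (dense_compl_singleton (0 : ℝ)) continuous_const fun ξ hξ => h ξ hξ
  refine h0 (funext fun t => ?_)
  have := hi'.fourierInv_fourier_eq (by rw [hF]; exact integrable_zero _ _ _)
    (v := t) (Complex.continuous_ofReal.comp hg).continuousAt
  rw [hF, Real.fourierInv_eq'] at this
  simpa using this.symm

/-- The real trigonometric function of frequency `ξ` with complex amplitude `z`. -/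
noncomputable def wave (ξ : ℝ) (z : ℂ) (t : ℝ) : ℝ :=
  (z * Complex.exp ((2 * Real.pi * (ξ * t) : ℝ) * Complex.I)).re

theorem contDiff_wave_uncurry {n : ℕ∞ω} (ξ : ℝ) :
    ContDiff ℝ n fun p : ℂ × ℝ => wave ξ p.1 p.2 := by
  unfold wave
  refine Complex.reCLM.contDiff.comp
    (contDiff_fst.mul (ContDiff.cexp (ContDiff.mul ?_ contDiff_const)))
  exact Complex.ofRealCLM.contDiff.comp
    (contDiff_const.mul (contDiff_const.mul contDiff_snd))

theorem abs_wave_le (ξ : ℝ) (z : ℂ) (t : ℝ) : |wave ξ z t| ≤ ‖z‖ := by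
  refine (Complex.abs_re_le_norm _).trans ?_
  rw [norm_mul, Complex.norm_exp_ofReal_mul_I, mul_one]

theorem iteratedDeriv_wave (ξ : ℝ) (z : ℂ) (k : ℕ) :
    iteratedDeriv k (wave ξ z) = wave ξ (z * ((2 * Real.pi * ξ : ℝ) * Complex.I) ^ k) := by
  induction k with
  | zero => simp
  | succ k ih =>
    rw [iteratedDeriv_succ, ih]
    ext t
    have h1 : HasDerivAt (fun t : ℝ => ((2 * Real.pi * (ξ * t) : ℝ) : ℂ) * Complex.I)
        ((2 * Real.pi * ξ : ℝ) * Complex.I) t := by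
      refine HasDerivAt.mul_const (HasDerivAt.ofReal_comp ?_) _
      simpa [mul_assoc] using ((hasDerivAt_id t).const_mul ξ).const_mul (2 * Real.pi)
    have h2 := Complex.reCLM.hasFDerivAt.comp_hasDerivAt t
      (h1.cexp.const_mul (z * ((2 * Real.pi * ξ : ℝ) * Complex.I) ^ k))
    refine h2.deriv.trans ?_
    simp only [wave, Complex.reCLM_apply]
    congr 1
    ring

/-- Exponentials are eigenfunctions of convolution with `g`; since `g` is real, the real part
commutes with the integral. -/
theorem integral_wave_mul {g : ℝ → ℝ} (hi : Integrable g) (ξ : ℝ) (z : ℂ) (t : ℝ) :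
    ∫ y, wave ξ z y * g (t - y) = wave ξ (z * 𝓕 (fun t => (g t : ℂ)) ξ) t := by
  have h1 : Integrable fun y => z * Complex.exp ((2 * Real.pi * (ξ * y) : ℝ) * Complex.I) *
      (g (t - y) : ℂ) := by
    refine ((hi.comp_sub_left t).ofReal).bdd_mul (c := ‖z‖)
      (Continuous.aestronglyMeasurable (by fun_prop)) (.of_forall fun y => ?_)
    rw [norm_mul, Complex.norm_exp_ofReal_mul_I, mul_one]
  have h2 : ∀ y, wave ξ z y * g (t - y) = RCLike.re
      (z * Complex.exp ((2 * Real.pi * (ξ * y) : ℝ) * Complex.I) * (g (t - y) : ℂ)) := fun y =>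
    (Complex.re_mul_ofReal _ _).symm
  simp_rw [h2]
  rw [integral_re (𝕜 := ℂ) h1, wave, Real.fourier_eq', ← integral_sub_left_eq_self
    (fun v : ℝ => Complex.exp ((-2 * Real.pi * inner ℝ v ξ : ℝ) * Complex.I) • (g v : ℂ)) _ t,
    mul_right_comm,
    ← integral_const_mul]
  refine congrArg Complex.re (integral_congr_ae (.of_forall fun y => ?_))
  simp only [smul_eq_mul, RCLike.inner_apply, conj_trivial]
  rw [mul_assoc z, mul_assoc z, ← mul_assoc (Complex.exp _), ← Complex.exp_add]
  congr 4
  push_cast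
  ring

end Line

/-! ### Density of the span of ridge functions -/

section Ridge

open scoped Convolution ContDiff FourierTransform

variable {E : Type*} [NormedAddCommGroup E] [InnerProductSpace ℝ E] {r : ℕ}

theorem contDiff_ridge {φ : ℝ → ℝ} (hφ : ContDiff ℝ r φ) (w : E) (b : ℝ) :
    ContDiff ℝ r fun x : E => φ (inner ℝ w x + b) :=
  hφ.comp ((contDiff_const.inner ℝ contDiff_id).add contDiff_const)

theorem norm_iteratedFDeriv_ridge_le {φ : ℝ → ℝ} (hφ : ContDiff ℝ r φ) (w : E) (b : ℝ) {i : ℕ}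
    (hi : i ≤ r) (x : E) : ‖iteratedFDeriv ℝ i (fun x : E => φ (inner ℝ w x + b)) x‖ ≤
      |iteratedDeriv i φ (inner ℝ w x + b)| * ‖w‖ ^ i := by
  have h := (innerSL ℝ w).iteratedFDeriv_comp_right (f := fun t => φ (t + b))
    (hφ.comp (contDiff_id.add contDiff_const)) x (i := i) (by exact_mod_cast hi)
  change iteratedFDeriv ℝ i (fun x : E => φ (inner ℝ w x + b)) x = _ at h
  rw [h, iteratedFDeriv_comp_add_right]
  refine (ContinuousMultilinearMap.norm_compContinuousLinearMap_le _ _).trans_eq ?_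
  rw [norm_iteratedFDeriv_eq_norm_iteratedDeriv]
  simp

variable {K : Set E} [CompactSpace K]

/-- The submodule `A` contains the jets of all the ridge functions of profile `φ`. -/
def ContainsRidges (A : Submodule ℝ (JetSpace r K)) (φ : ℝ → ℝ) : Prop :=
  ∀ (w : E) (b : ℝ) (h : ContDiff ℝ r fun x : E => φ (inner ℝ w x + b)), jet K _ h ∈ A

variable {A : Submodule ℝ (JetSpace r K)} (hA : IsClosed (A : Set (JetSpace r K)))

include hA

/-- Convolving the profile averages ridge functions over the bias `b - y`, with weight `φ y`. -/
theorem ContainsRidges.convolution {σ : ℝ → ℝ} (hσ : ContDiff ℝ r σ) (h : ContainsRidges A σ)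
    [FiniteDimensional ℝ E] {φ : ℝ → ℝ} (hφ : HasCompactSupport φ) (hφ' : ContDiff ℝ ∞ φ) :
    ContainsRidges A (φ ⋆ σ) := by
  intro w b hd
  have hF : ContDiff ℝ r (Function.uncurry fun (y : ℝ) (x : E) =>
      φ y * σ (inner ℝ w x + (b - y))) :=
    ((hφ'.of_le (by exact_mod_cast le_top)).comp contDiff_fst).mul (hσ.comp
      ((contDiff_const.inner ℝ contDiff_snd).add (contDiff_const.sub contDiff_fst)))
  have hB := LocallyDominated.of_isCompact (μ := volume) hφ hF fun y hy => by
    ext x; simp [image_eq_zero_of_notMem_tsupport hy]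
  have key := hB.jet_integral_mem hA hF fun y => by
    rw [jet_const_smul (φ y) (contDiff_ridge hσ w (b - y))]
    exact A.smul_mem _ (h _ _ _)
  convert! key using 2
  ext x
  simp only [convolution_def, add_sub_assoc]
  rfl

theorem ContainsRidges.trigonometric {g : ℝ → ℝ} (hg : ContDiff ℝ r g) (h : ContainsRidges A g)
    (hi : Integrable g) (hdom : ∀ i ≤ r, ∀ R : ℝ, ∃ B : ℝ → ℝ, Integrable B ∧
      ∀ t y, |t| ≤ R → |iteratedDeriv i g (t - y)| ≤ B y)
    {ξ : ℝ} (hξ : 𝓕 (fun t => (g t : ℂ)) ξ ≠ 0) (z : ℂ) : ContainsRidges A (wave ξ z) := by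
  intro w b hd
  -- Chosen so that the Fourier factor produced by the convolution cancels and leaves amplitude `z`.
  let u : ℂ := z / 𝓕 (fun t => (g t : ℂ)) ξ
  have hF : ContDiff ℝ r (Function.uncurry fun (y : ℝ) (x : E) =>
      wave ξ u y * g (inner ℝ w x + (b - y))) :=
    ((contDiff_wave_uncurry ξ).comp (contDiff_const.prodMk contDiff_fst)).mul (hg.comp
      ((contDiff_const.inner ℝ contDiff_snd).add (contDiff_const.sub contDiff_fst)))
  have hB : LocallyDominated volume r fun (y : ℝ) (x : E) =>
      wave ξ u y * g (inner ℝ w x + (b - y)) := by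
    intro i hir R
    obtain ⟨B, hBi, hBb⟩ := hdom i hir (‖w‖ * R + |b|)
    refine ⟨fun y => ‖u‖ * (B y * ‖w‖ ^ i), (hBi.mul_const _).const_mul _, fun y x hx => ?_⟩
    have h1 : iteratedFDeriv ℝ i (fun x : E => wave ξ u y * g (inner ℝ w x + (b - y))) x =
        wave ξ u y • iteratedFDeriv ℝ i (fun x : E => g (inner ℝ w x + (b - y))) x :=
      iteratedFDeriv_const_smul_apply (a := wave ξ u y)
        ((contDiff_ridge hg w (b - y)).of_le (by exact_mod_cast hir)).contDiffAt
    rw [h1, norm_smul]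
    refine mul_le_mul (abs_wave_le _ _ _) ((norm_iteratedFDeriv_ridge_le hg w _ hir x).trans ?_)
      (norm_nonneg _) (norm_nonneg _)
    refine mul_le_mul_of_nonneg_right ?_ (by positivity)
    rw [← add_sub_assoc]
    refine hBb _ y ((abs_add_le _ _).trans (add_le_add_left ?_ _))
    exact (abs_real_inner_le_norm _ _).trans (mul_le_mul_of_nonneg_left hx (norm_nonneg _))
  have key := hB.jet_integral_mem hA hF fun y => by
    rw [jet_const_smul _ (contDiff_ridge hg w (b - y))]
    exact A.smul_mem _ (h _ _ _)
  convert! key using 2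
  ext x
  simp only [← add_sub_assoc]
  rw [integral_wave_mul hi, div_mul_cancel₀ _ hξ]

variable [FiniteDimensional ℝ E]

theorem IsEllFinite.exists_containsRidges_wave {ℓ : ℕ} {σ : ℝ → ℝ} (hσ : IsEllFinite ℓ σ)
    (hr : r ≤ ℓ) (h : ContainsRidges A σ) :
    ∃ ξ : ℝ, ξ ≠ 0 ∧ ∀ z : ℂ, ContainsRidges A (wave ξ z) := by
  obtain ⟨hσc, hσ0, hσi⟩ := hσ
  have hsc : Continuous (iteratedDeriv ℓ σ) := hσc.continuous_iteratedDeriv ℓ le_rfl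
  have hsi : Integrable (iteratedDeriv ℓ σ) := ⟨hsc.aestronglyMeasurable, hσi⟩
  have hs0 : iteratedDeriv ℓ σ ≠ 0 := by
    intro h0
    simp [h0] at hσ0
  obtain ⟨φ, hφ, hφ', hne⟩ := exists_convolution_ne_zero hsc hs0
  have hgc : ContDiff ℝ ∞ (φ ⋆ iteratedDeriv ℓ σ) :=
    hφ.contDiff_convolution_left _ hφ' hsc.locallyIntegrable
  have hφi : Integrable φ := hφ'.continuous.integrable_of_hasCompactSupport hφ
  have hgi : Integrable (φ ⋆ iteratedDeriv ℓ σ) := hφi.integrable_convolution _ hsi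
  obtain ⟨ξ, hξ0, hξ⟩ := exists_fourier_ne_zero hgc.continuous hgi hne
  have hgA : ContainsRidges A (φ ⋆ iteratedDeriv ℓ σ) := by
    rw [hφ.convolution_iteratedDeriv hφ' hσc]
    exact ContainsRidges.convolution hA (hσc.of_le (by exact_mod_cast hr)) h
      (hφ.iterated_deriv ℓ) (hφ'.iterated_deriv ℓ)
  refine ⟨ξ, hξ0, fun z => ContainsRidges.trigonometric hA
    (hgc.of_le (by exact_mod_cast le_top)) hgA hgi (fun i _ R => ?_) hξ z⟩
  rw [hφ.iteratedDeriv_convolution_left hφ' hsc.locallyIntegrable]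
  exact (hφ.iterated_deriv i).exists_integrable_bound_convolution
    (hφ'.iterated_deriv i).continuous hsi R

variable [MeasurableSpace E] [BorelSpace E]

theorem jet_mem_of_contDiff_of_hasCompactSupport {ξ : ℝ} (hξ : ξ ≠ 0)
    (hw : ∀ z : ℂ, ContainsRidges A (wave ξ z)) {f : E → ℝ} (hf : HasCompactSupport f)
    (hf' : ContDiff ℝ ∞ f) (hfr : ContDiff ℝ r f) : jet K f hfr ∈ A := by
  let fC : SchwartzMap E ℂ := HasCompactSupport.toSchwartzMap (f := fun x => (f x : ℂ))
    (hf.comp_left Complex.ofReal_zero) (Complex.ofRealCLM.contDiff.comp hf')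
  let c : SchwartzMap E ℂ := 𝓕 fC
  have hinv : ∀ x, f x = ∫ w, wave 1 (c w) (inner ℝ w x) := by
    intro x
    have h1 : 𝓕⁻ (c : E → ℂ) x = (f x : ℂ) := by
      rw [← SchwartzMap.fourierInv_coe]
      exact congrArg (fun F : SchwartzMap E ℂ => F x) (FourierTransform.fourierInv_fourier_eq fC)
    have h2 : Integrable fun w =>
        Complex.exp ((2 * Real.pi * inner ℝ w x : ℝ) * Complex.I) * c w :=
      c.integrable.bdd_mul (c := 1) (Continuous.aestronglyMeasurable (by fun_prop))
        (.of_forall fun y => by rw [Complex.norm_exp_ofReal_mul_I])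
    rw [Real.fourierInv_eq'] at h1
    have h3 := integral_re (𝕜 := ℂ) h2
    simp only [smul_eq_mul] at h1
    rw [h1] at h3
    refine Eq.trans h3.symm (integral_congr_ae (.of_forall fun w => ?_))
    simp [wave, mul_comm]
  have hF : ContDiff ℝ r (Function.uncurry fun (w : E) (x : E) => wave 1 (c w) (inner ℝ w x)) :=
    (contDiff_wave_uncurry 1).comp (((c.smooth r).comp contDiff_fst).prodMk
      (contDiff_fst.inner ℝ contDiff_snd))
  have hB : LocallyDominated volume r fun (w : E) (x : E) => wave 1 (c w) (inner ℝ w x) := by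
    intro i hi R
    -- Each derivative in `x` costs a factor `2π‖w‖`, absorbed by the rapid decay of the Schwartz
    -- function `c`.
    refine ⟨fun w => (2 * Real.pi) ^ i * (‖w‖ ^ i * ‖c w‖),
      (c.integrable_pow_mul volume i).const_mul _, fun w x _ => ?_⟩
    have h1 := norm_iteratedFDeriv_ridge_le (r := r) (φ := wave 1 (c w))
      ((contDiff_wave_uncurry 1).comp (contDiff_const.prodMk contDiff_id)) w 0 hi x
    simp only [add_zero] at h1
    refine h1.trans ?_
    rw [iteratedDeriv_wave]
    have h2 := abs_wave_le 1 (c w * ((2 * Real.pi * 1 : ℝ) * Complex.I) ^ i) (inner ℝ w x)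
    rw [norm_mul, norm_pow, norm_mul, Complex.norm_I, mul_one, mul_one, Complex.norm_real,
      Real.norm_of_nonneg (by positivity)] at h2
    calc _ ≤ ‖c w‖ * (2 * Real.pi) ^ i * ‖w‖ ^ i := by gcongr; simpa using h2
      _ = _ := by ring
  have key := hB.jet_integral_mem hA hF fun w => by
    -- Frequency 1 with weight `w` is frequency `ξ` with weight `ξ⁻¹ • w`; this is where `ξ ≠ 0` is
    -- needed.
    have h1 : (fun x : E => wave 1 (c w) (inner ℝ w x)) =
        fun x : E => wave ξ (c w) (inner ℝ (ξ⁻¹ • w) x + 0) := by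
      ext x
      rw [wave, wave, inner_smul_left, add_zero, conj_trivial, one_mul,
        mul_inv_cancel_left₀ hξ]
    rw [jet_congr h1 _ (h1 ▸ hF.of_uncurry w)]
    exact hw _ _ _ _
  convert! key using 2
  exact funext hinv

/-- The jet of the translate `f (· + y)` is continuous in `y`, so its averages against mollifiers
tend to the jet of `f`. These averages are jets of the smooth functions `ψ k ⋆ f`. -/
theorem jet_mem_of_hasCompactSupport {ξ : ℝ} (hξ : ξ ≠ 0)
    (hw : ∀ z : ℂ, ContainsRidges A (wave ξ z)) {f : E → ℝ} (hf : HasCompactSupport f)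
    (hfr : ContDiff ℝ r f) : jet K f hfr ∈ A := by
  let ψ : ℕ → ContDiffBump (0 : E) := fun k =>
    ⟨1 / (k + 1 : ℝ) / 2, 1 / (k + 1 : ℝ), by positivity, half_lt_self (by positivity)⟩
  have hT : ContDiff ℝ r (Function.uncurry fun (y : E) (x : E) => f (x + y)) :=
    hfr.comp (contDiff_snd.add contDiff_fst)
  have ht := ContDiffBump.convolution_tendsto_right_of_continuous (μ := volume) (φ := ψ)
    (l := Filter.atTop) tendsto_one_div_add_atTop_nhds_zero_nat (continuous_jet (K := K) hT) 0
  rw [jet_congr (by simp : (fun x => f (x + 0)) = f) _ hfr] at ht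
  refine hA.mem_of_tendsto ht (.of_forall fun k => ?_)
  have hψ := (ψ k).hasCompactSupport_normed (μ := volume)
  have hψ' : ContDiff ℝ ∞ ((ψ k).normed volume) := (ψ k).contDiff_normed
  have hF : ContDiff ℝ r (Function.uncurry fun (y : E) (x : E) =>
      (ψ k).normed volume y * f (x + (0 - y))) :=
    ((hψ'.of_le (by exact_mod_cast le_top)).comp contDiff_fst).mul
      (hfr.comp (contDiff_snd.add (contDiff_const.sub contDiff_fst)))
  have hB := LocallyDominated.of_isCompact (μ := volume) hψ hF fun y hy => by
    ext x; simp [image_eq_zero_of_notMem_tsupport hy]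
  have h1 : (fun x => ∫ y, (ψ k).normed volume y * f (x + (0 - y))) =
      (ψ k).normed volume ⋆ f := by
    ext x
    simp only [convolution_def, zero_sub, ← sub_eq_add_neg]
    rfl
  have h2 := hB.jet_integral (K := K) hF
  have h3 := jet_mem_of_contDiff_of_hasCompactSupport (K := K) hA hξ hw
    (hψ.convolution (ContinuousLinearMap.lsmul ℝ ℝ) hf (μ := volume))
    (hψ.contDiff_convolution_left _ hψ' hfr.continuous.locallyIntegrable)
    (h1 ▸ hB.contDiff_integral hF)
  rw [← jet_congr h1 (hB.contDiff_integral hF), h2] at h3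
  convert! h3 using 1
  rw [convolution_def]
  refine integral_congr_ae (.of_forall fun y => ?_)
  exact (jet_const_smul _ (hT.of_uncurry (0 - y))).symm

end Ridge

/-! ### Cutting off -/

section Cutoff

open scoped ContDiff Manifold

variable {E : Type*} [NormedAddCommGroup E] [NormedSpace ℝ E]

/-- Multiply by a smooth cutoff equal to 1 near `K`. Agreement of germs, not just of values on `K`,
preserves the derivatives in `crNorm`. -/
theorem ContDiffOn.exists_contDiff_eventuallyEq [FiniteDimensional ℝ E] {r : ℕ} {K U : Set E}
    (hK : IsCompact K) (hU : IsOpen U) (hKU : K ⊆ U) {f : E → ℝ} (hf : ContDiffOn ℝ r f U) :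
    ∃ f' : E → ℝ, ContDiff ℝ r f' ∧ HasCompactSupport f' ∧ ∀ x ∈ K, f' =ᶠ[nhds x] f := by
  obtain ⟨L, hL, hKL, hLU⟩ := exists_compact_between hK hU hKU
  obtain ⟨L', hL', hLL', hLU'⟩ := exists_compact_between hL hU hLU
  obtain ⟨χ, hχ1, hχ0, -⟩ := exists_contMDiffMap_one_nhds_of_subset_interior (n := ⊤) 𝓘(ℝ, E)
    hL.isClosed hLL'
  have hχc : ContDiff ℝ ∞ χ := χ.contMDiff.contDiff
  have hχs : tsupport χ ⊆ L' := closure_minimal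
    (fun x hx => by_contra fun h => hx (hχ0 x h)) hL'.isClosed
  refine ⟨fun x => χ x * f x, contDiff_iff_contDiffAt.2 fun x => ?_,
    HasCompactSupport.mul_right (hL'.of_isClosed_subset (isClosed_tsupport _) hχs),
    fun x hx => ?_⟩
  · by_cases hx : x ∈ tsupport χ
    · exact (hχc.of_le (by exact_mod_cast le_top)).contDiffAt.mul
        (hf.contDiffAt (hU.mem_nhds (hLU' (hχs hx))))
    · refine (contDiffAt_const (c := (0 : ℝ))).congr_of_eventuallyEq ?_
      filter_upwards [(isClosed_tsupport χ).isOpen_compl.mem_nhds hx] with y hy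
      rw [image_eq_zero_of_notMem_tsupport hy, zero_mul]
  · filter_upwards [hχ1.filter_mono (nhds_le_nhdsSet (interior_subset (hKL hx)))] with y hy
    rw [hy, one_mul]

theorem crNorm_congr {r : ℕ} {K : Set E} {g h : E → ℝ} (hgh : ∀ x ∈ K, g =ᶠ[nhds x] h) :
    crNorm r K g = crNorm r K h :=
  Finset.sum_congr rfl fun i _ => iSup_congr fun x => iSup_congr fun hx => by
    rw [((hgh x hx).iteratedFDeriv ℝ i).eq_of_nhds]

end Cutoff

/-! ### Hitting open sets by independent samples -/

/-- Union bound: `N` samples all miss `O k` with probability `q k ^ N`, where `q k < 1` by full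
support, and the finite sum of these tends to 0. -/
theorem exists_lt_measureReal_forall_exists_mem {Ω T : Type*} [MeasurableSpace Ω] {P : Measure Ω}
    [IsProbabilityMeasure P] [TopologicalSpace T] [MeasurableSpace T] [OpensMeasurableSpace T]
    {X : ℕ → Ω → T} (hX : ∀ j, Measurable (X j)) (hindep : iIndepFun X P)
    (hident : ∀ j, IdentDistrib (X j) (X 0) P P) (hsupp : (P.map (X 0)).IsOpenPosMeasure)
    {M : ℕ} {O : Fin M → Set T} (hO : ∀ k, IsOpen (O k)) (hne : ∀ k, (O k).Nonempty)
    {α : ℝ} (hα : α < 1) :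
    ∃ N : ℕ, α < P.real {ω | ∀ k, ∃ j : Fin N, X j ω ∈ O k} := by
  let q : Fin M → ℝ := fun k => P.real (X 0 ⁻¹' (O k)ᶜ)
  have hq : ∀ k, q k < 1 := by
    intro k
    have h1 : P (X 0 ⁻¹' O k) ≠ 0 := by
      rw [← Measure.map_apply (hX 0) (hO k).measurableSet]
      exact hsupp.open_pos _ (hO k) (hne k)
    have h2 : 0 < P.real (X 0 ⁻¹' O k) := ENNReal.toReal_pos h1 (measure_ne_top _ _)
    have h3 : q k = 1 - P.real (X 0 ⁻¹' O k) :=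
      probReal_compl_eq_one_sub (hX 0 (hO k).measurableSet)
    linarith
  have ht : Filter.Tendsto (fun N : ℕ => ∑ k, q k ^ N) Filter.atTop (nhds 0) := by
    simpa only [Finset.sum_const_zero] using tendsto_finsetSum Finset.univ fun k _ =>
      tendsto_pow_atTop_nhds_zero_of_lt_one (r := q k) measureReal_nonneg (hq k)
  obtain ⟨N, hN⟩ := (ht.eventually_lt_const (sub_pos.2 hα)).exists
  refine ⟨N, ?_⟩
  set S : Set Ω := {ω | ∀ k, ∃ j : Fin N, X j ω ∈ O k}
  have hS : MeasurableSet S := by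
    have : S = ⋂ k, ⋃ j : Fin N, X j ⁻¹' O k := by ext ω; simp [S]
    rw [this]
    exact .iInter fun k => .iUnion fun j => hX j (hO k).measurableSet
  have hSc : Sᶜ = ⋃ k, ⋂ j ∈ Finset.range N, X j ⁻¹' (O k)ᶜ := by
    ext ω
    simp only [S, Set.mem_compl_iff, Set.mem_ofPred_eq, not_forall, not_exists, Set.mem_iUnion]
    exact exists_congr fun k => by simp [Fin.forall_iff]
  have hle : P.real Sᶜ ≤ ∑ k, q k ^ N := by
    rw [hSc]
    refine (measureReal_iUnion_fintype_le _).trans_eq (Finset.sum_congr rfl fun k _ => ?_)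
    have hm : MeasurableSet (O k)ᶜ := (hO k).measurableSet.compl
    rw [measureReal_def, hindep.measure_inter_preimage_eq_mul _ fun _ _ => hm,
      Finset.prod_congr rfl fun j _ => (hident j).measure_mem_eq hm, Finset.prod_const,
      Finset.card_range, ENNReal.toReal_pow]
    rfl
  rw [probReal_compl_eq_one_sub hS] at hle
  linarith

/-! ### The random universal approximation theorem -/

section Main

variable {n : ℕ} {r : ℕ} {K : Set (EuclideanSpace ℝ (Fin n))} [CompactSpace K] {σ : ℝ → ℝ}

variable (K) in
/-- The jet of the neuron with given bias and weight. -/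
noncomputable def neuronJet (hσ : ContDiff ℝ r σ) (θ : ℝ × EuclideanSpace ℝ (Fin n)) :
    JetSpace r K :=
  jet K (fun x => σ (inner ℝ θ.2 x + θ.1)) (contDiff_ridge hσ θ.2 θ.1)

theorem continuous_neuronJet (hσ : ContDiff ℝ r σ) : Continuous (neuronJet K hσ) :=
  continuous_jet (F := fun (θ : ℝ × EuclideanSpace ℝ (Fin n)) x => σ (inner ℝ θ.2 x + θ.1))
    (hσ.comp (((contDiff_snd.comp contDiff_fst).inner ℝ contDiff_snd).add
      (contDiff_fst.comp contDiff_fst)))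

theorem crNorm_sub_network (hσ : ContDiff ℝ r σ) {f : EuclideanSpace ℝ (Fin n) → ℝ}
    (hf : ContDiff ℝ r f) {N : ℕ} (W : Fin N → ℝ)
    (θ : Fin N → ℝ × EuclideanSpace ℝ (Fin n)) :
    crNorm r K (fun x => f x - network σ W (fun j => (θ j).2) (fun j => (θ j).1) x) =
      (jet K f hf - ∑ j, W j • neuronJet K hσ (θ j)).sumNorm := by
  have h := jet_sum_smul (K := K) Finset.univ W fun j => contDiff_ridge hσ (θ j).2 (θ j).1
  have h' := jet_sub (K := K) hf (ContDiff.sum (s := Finset.univ) fun j _ =>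
    contDiff_const.mul (contDiff_ridge hσ (θ j).2 (θ j).1) (f := fun _ => W j))
  rw [h] at h'
  unfold neuronJet
  rw [← h']
  exact crNorm_eq_sumNorm_jet _

theorem jet_mem_closure_span_neuronJet {ℓ : ℕ} (hσ : IsEllFinite ℓ σ) (hr : r ≤ ℓ)
    (hσr : ContDiff ℝ r σ) {f : EuclideanSpace ℝ (Fin n) → ℝ} (hf : ContDiff ℝ r f)
    (hfc : HasCompactSupport f) :
    jet K f hf ∈ closure (Submodule.span ℝ (Set.range (neuronJet K hσr)) : Set (JetSpace r K)) := by
  let A := (Submodule.span ℝ (Set.range (neuronJet K hσr))).topologicalClosure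
  have hA : IsClosed (A : Set (JetSpace r K)) := Submodule.isClosed_topologicalClosure _
  have h : ContainsRidges A σ := fun w b _ =>
    Submodule.le_topologicalClosure _ (Submodule.subset_span ⟨(b, w), rfl⟩)
  obtain ⟨ξ, hξ, hw⟩ := hσ.exists_containsRidges_wave hA hr h
  exact jet_mem_of_hasCompactSupport hA hξ hw hfc hf

/-- The parameters of the hidden layer for which some output weights give an approximation of `p`
with an error less than `ε`. -/
def goodParameters (hσ : ContDiff ℝ r σ) (p : JetSpace r K) (ε : ℝ≥0∞) (N : ℕ) :
    Set (Fin N → ℝ × EuclideanSpace ℝ (Fin n)) :=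
  {θ | ∃ W : Fin N → ℝ, (p - ∑ j, W j • neuronJet K hσ (θ j)).sumNorm < ε}

theorem isOpen_setOf_sumNorm_lt (hσ : ContDiff ℝ r σ) (p : JetSpace r K) (ε : ℝ≥0∞) {N : ℕ}
    (W : Fin N → ℝ) : IsOpen {θ : Fin N → ℝ × EuclideanSpace ℝ (Fin n) |
      (p - ∑ j, W j • neuronJet K hσ (θ j)).sumNorm < ε} :=
  isOpen_lt (JetSpace.continuous_sumNorm.comp (continuous_const.sub (continuous_finsetSum _
    fun j _ => ((continuous_neuronJet hσ).comp (continuous_apply j)).const_smul (W j))))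
    continuous_const

theorem isOpen_goodParameters (hσ : ContDiff ℝ r σ) (p : JetSpace r K) (ε : ℝ≥0∞) (N : ℕ) :
    IsOpen (goodParameters hσ p ε N) := by
  rw [goodParameters, Set.ofPred_exists]
  exact isOpen_iUnion fun W => isOpen_setOf_sumNorm_lt hσ p ε W

theorem mem_goodParameters_of_comp {hσ : ContDiff ℝ r σ} {p : JetSpace r K} {ε : ℝ≥0∞} {M N : ℕ}
    {θ : Fin N → ℝ × EuclideanSpace ℝ (Fin n)} (m : Fin M → Fin N)
    (h : θ ∘ m ∈ goodParameters hσ p ε M) : θ ∈ goodParameters hσ p ε N := by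
  obtain ⟨W, hW⟩ := h
  -- `m` need not be injective: a neuron serving several `k` gets the sum of their weights, and one
  -- serving none gets 0.
  refine ⟨fun j => ∑ k with m k = j, W k, ?_⟩
  convert! hW using 3
  rw [← Finset.sum_fiberwise Finset.univ m]
  refine Finset.sum_congr rfl fun j _ => ?_
  rw [Finset.sum_smul]
  refine Finset.sum_congr rfl fun k hk => ?_
  rw [Function.comp_apply, (Finset.mem_filter.1 hk).2]

theorem exists_pi_subset_goodParameters {hσ : ContDiff ℝ r σ} {p : JetSpace r K}
    (hp : p ∈ closure (Submodule.span ℝ (Set.range (neuronJet K hσ)) : Set (JetSpace r K)))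
    {ε : ℝ≥0∞} (hε : 0 < ε) :
    ∃ (M : ℕ) (O : Fin M → Set (ℝ × EuclideanSpace ℝ (Fin n))), (∀ k, IsOpen (O k)) ∧
      (∀ k, (O k).Nonempty) ∧ Set.univ.pi O ⊆ goodParameters hσ p ε M := by
  have ho : IsOpen {q : JetSpace r K | (p - q).sumNorm < ε} :=
    isOpen_lt (JetSpace.continuous_sumNorm.comp (continuous_const.sub continuous_id))
      continuous_const
  obtain ⟨q, hqε, hq⟩ := mem_closure_iff.1 hp _ ho
    (by
      change (p - p).sumNorm < ε
      rwa [sub_self, JetSpace.sumNorm_zero])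
  obtain ⟨M, c, g, rfl⟩ := Submodule.mem_span_set'.1 hq
  choose θ hθ using fun k => (g k).2
  have hmem : θ ∈ goodParameters hσ p ε M := ⟨c, by simp only [hθ]; exact hqε⟩
  obtain ⟨O, hO, hsub⟩ := isOpen_pi_iff'.1 (isOpen_goodParameters hσ p ε M) θ hmem
  exact ⟨M, O, fun k => (hO k).1, fun k => ⟨_, (hO k).2⟩, hsub⟩

end Main

theorem mainTheorem5 {n : ℕ} {Ω : Type*} [MeasurableSpace Ω] (P : Measure Ω)
    [IsProbabilityMeasure P]
    (K U : Set (EuclideanSpace ℝ (Fin n))) (hK : IsCompact K) (hU : IsOpen U) (hKU : K ⊆ U)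
    (ℓ : ℕ) (f : EuclideanSpace ℝ (Fin n) → ℝ) (hf : ContDiffOn ℝ ℓ f U)
    (σ : ℝ → ℝ) (hσ : IsEllFinite ℓ σ)
    (b : ℕ → Ω → ℝ) (C : ℕ → Ω → EuclideanSpace ℝ (Fin n))
    (hb : ∀ j, Measurable (b j)) (hC : ∀ j, Measurable (C j))
    (hindep : iIndepFun (fun j ω => (b j ω, C j ω)) P)
    (hident : ∀ j, IdentDistrib (fun ω => (b j ω, C j ω)) (fun ω => (b 0 ω, C 0 ω)) P P)
    (hsupp : (P.map (fun ω => (b 0 ω, C 0 ω))).IsOpenPosMeasure)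
    (r : ℕ) (hr : r ≤ ℓ) (α : ℝ) (hα : α < 1) (ε : ℝ) (hε : 0 < ε) :
    ∃ N : ℕ,
      MeasurableSet {ω | ∃ W : Fin N → ℝ,
        crNorm r K (fun x => f x - network σ W (fun j => C j ω) (fun j => b j ω) x)
          < ENNReal.ofReal ε} ∧
      α < P.real {ω | ∃ W : Fin N → ℝ,
        crNorm r K (fun x => f x - network σ W (fun j => C j ω) (fun j => b j ω) x)
          < ENNReal.ofReal ε} := by
  have : CompactSpace K := isCompact_iff_compactSpace.1 hK
  have hσr : ContDiff ℝ r σ := hσ.1.of_le (by exact_mod_cast hr)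
  obtain ⟨f', hf', hfc, hff⟩ :=
    (hf.of_le (m := r) (by exact_mod_cast hr)).exists_contDiff_eventuallyEq hK hU hKU
  let X : ℕ → Ω → ℝ × EuclideanSpace ℝ (Fin n) := fun j ω => (b j ω, C j ω)
  have hX : ∀ j, Measurable (X j) := fun j => (hb j).prodMk (hC j)
  have hset : ∀ N : ℕ, {ω | ∃ W : Fin N → ℝ,
      crNorm r K (fun x => f x - network σ W (fun j => C j ω) (fun j => b j ω) x)
        < ENNReal.ofReal ε} = (fun ω (j : Fin N) => X j ω) ⁻¹'
          goodParameters hσr (jet K f' hf') (ENNReal.ofReal ε) N := by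
    intro N
    ext ω
    refine exists_congr fun W => ?_
    rw [← crNorm_sub_network hσr hf' W fun j : Fin N => X j ω]
    -- The error only sees germs along `K`, so `f` may be replaced by its globally `C^r` substitute
    -- `f'`.
    rw [crNorm_congr fun x hx => (hff x hx).symm.fun_sub (Filter.EventuallyEq.refl _ _)]
  obtain ⟨M, O, hO, hne, hsub⟩ := exists_pi_subset_goodParameters
    (jet_mem_closure_span_neuronJet (K := K) hσ hr hσr hf' hfc) (ENNReal.ofReal_pos.2 hε)
  obtain ⟨N, hN⟩ := exists_lt_measureReal_forall_exists_mem hX hindep hident hsupp hO hne hα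
  refine ⟨N, ?_, ?_⟩
  · rw [hset]
    have hm : Measurable fun ω (j : Fin N) => X j ω := measurable_pi_lambda _ fun j => hX j
    exact hm (isOpen_goodParameters hσr _ _ N).measurableSet
  · rw [hset]
    refine hN.trans_le (measureReal_mono fun ω hω => ?_)
    choose m hm using hω
    exact mem_goodParameters_of_comp m (hsub fun k _ => hm k)
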